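/- Let $n\ge 1$ and let $\Omega\subset\mathbb R^n$ be a bounded domain (nonempty connected open set) of class $C^1$, i.e. near each boundary point, in suitable orthonormal coordinates, $\Omega$ is the region strictly above the graph of a $C^1$ function. Let $\varphi:\overline\Omega\to\mathbb R$ and $f:\partial\Omega\to\mathbb R$ be of class $C^1$, with $f\ge\varphi$ on $\partial\Omega$. Let $$\mathcal K_\varphi:=\{v\in W^{1,2}(\Omega)\;:\; v|_{\partial\Omega}=f,\ v\ge\varphi \text{ a.e. in } \Omega\},$$ where $v|_{\partial\Omega}=f$ is understood in the sense of traces: there are functions $w_k\in C^1(\mathbb R^n)$ with $w_k\to v$ in $W^{1,2}(\Omega)$ and $w_k|_{\partial\Omega}\to f$ in $L^2(\partial\Omega,\mathcal H^{n-1})$. Then there exists exactly one $u\in\mathcal K_\varphi$ (as an element of $W^{1,2}(\Omega)$, i.e. up to a.e. equality) such that $$\int_\Omega\frac{|\nabla u|^2}{2}\le\int_\Omega\frac{|\nabla v|^2}{2}\qquad\text{for all } v\in\mathcal K_\varphi .$$ -/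

import Mathlib

open MeasureTheory Filter Topology
open scoped ENNReal ContDiff MeasureTheory

/-- `ℝⁿ` with its Euclidean norm. -/
abbrev Euc (n : ℕ) : Type := EuclideanSpace ℝ (Fin n)

/-- A bounded domain of class `C¹` in `ℝⁿ`: a bounded, nonempty, connected open set which near each
boundary point `x₀` is, for a suitable unit vector `ν` (the "vertical" direction), the region
strictly above the graph of a `C¹` function `γ` on the hyperplane orthogonal to `ν`. -/
structure IsBoundedC1Domain {n : ℕ} (Ω : Set (Euc n)) : Prop where
  isOpen : IsOpen Ω
  isConnected : IsConnected Ω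
  isBounded : Bornology.IsBounded Ω
  boundary_graph : ∀ x₀ ∈ frontier Ω, ∃ r : ℝ, 0 < r ∧ ∃ ν : Euc n, ‖ν‖ = 1 ∧
    ∃ γ : (Submodule.span ℝ {ν})ᗮ → ℝ, ContDiff ℝ 1 γ ∧
      ∀ x ∈ Metric.ball x₀ r,
        (x ∈ Ω ↔ γ ((Submodule.span ℝ {ν})ᗮ.orthogonalProjectionOnto x) < inner ℝ ν x)

/-- `g` is the weak (distributional) gradient of `u` in `Ω`:
`∫_Ω u ∇ψ = - ∫_Ω ψ g` for all test functions `ψ ∈ C_c^∞(Ω)`. -/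
def HasWeakGradient {n : ℕ} (Ω : Set (Euc n)) (u : Euc n → ℝ) (g : Euc n → Euc n) : Prop :=
  ∀ ψ : Euc n → ℝ, ContDiff ℝ ∞ ψ → HasCompactSupport ψ → tsupport ψ ⊆ Ω →
    ∫ x in Ω, u x • gradient ψ x = - ∫ x in Ω, ψ x • g x

/-- An `L²` weak gradient is unique. -/
theorem HasWeakGradient.unique {n : ℕ} {Ω : Set (Euc n)} (hΩ : IsOpen Ω) {u : Euc n → ℝ}
    {g h : Lp (Euc n) 2 (volume.restrict Ω)}
    (hg : HasWeakGradient Ω u g) (hh : HasWeakGradient Ω u h) : g = h := by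
  have hloc : ∀ k : Lp (Euc n) 2 (volume.restrict Ω), LocallyIntegrable k (volume.restrict Ω) :=
    fun k => (Lp.memLp k).locallyIntegrable (by norm_num)
  have key := hΩ.ae_eq_zero_of_integral_contDiff_smul_eq_zero (μ := volume.restrict Ω)
    (f := fun x => g x - h x) (((hloc g).sub (hloc h)).locallyIntegrableOn Ω) (by
      intro ψ hψ hc hs
      have hi : ∀ k : Lp (Euc n) 2 (volume.restrict Ω),
          Integrable (fun x => ψ x • k x) (volume.restrict Ω) := fun k =>
        (hloc k).integrable_smul_left_of_hasCompactSupport hψ.continuous hc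
      have h1 := hg ψ hψ hc hs
      have h2 := hh ψ hψ hc hs
      simp only [smul_sub]
      rw [integral_sub (hi g) (hi h), sub_eq_zero]
      exact neg_injective (h1.symm.trans h2))
  refine Lp.ext ?_
  have hm : ∀ᵐ x ∂(volume.restrict Ω), x ∈ Ω := ae_restrict_mem hΩ.measurableSet
  filter_upwards [key, hm] with x hx hxΩ using sub_eq_zero.mp (hx hxΩ)

/-- The Sobolev space `W^{1,2}(Ω)`: the (classes of) functions in `L²(Ω)` which have a weak gradient
in `L²(Ω; ℝⁿ)`. -/
def W12 {n : ℕ} (Ω : Set (Euc n)) : Set (Lp ℝ 2 (volume.restrict Ω)) :=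
  {u | ∃ g : Lp (Euc n) 2 (volume.restrict Ω), HasWeakGradient Ω u g}

open Classical in
/-- The weak gradient `∇u ∈ L²(Ω; ℝⁿ)` of `u ∈ W^{1,2}(Ω)` (and `0` if `u ∉ W^{1,2}(Ω)`). -/
noncomputable def weakGradient {n : ℕ} (Ω : Set (Euc n)) (u : Lp ℝ 2 (volume.restrict Ω)) :
    Lp (Euc n) 2 (volume.restrict Ω) :=
  if h : u ∈ W12 Ω then h.choose else 0

theorem hasWeakGradient_weakGradient {n : ℕ} {Ω : Set (Euc n)}
    {u : Lp ℝ 2 (volume.restrict Ω)} (hu : u ∈ W12 Ω) :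
    HasWeakGradient Ω u (weakGradient Ω u) := by
  simp only [weakGradient, dif_pos hu]
  exact hu.choose_spec

theorem HasWeakGradient.weakGradient_eq {n : ℕ} {Ω : Set (Euc n)} (hΩ : IsOpen Ω)
    {u : Lp ℝ 2 (volume.restrict Ω)} {g : Lp (Euc n) 2 (volume.restrict Ω)}
    (hg : HasWeakGradient Ω u g) : weakGradient Ω u = g :=
  (hasWeakGradient_weakGradient (Ω := Ω) ⟨g, hg⟩).unique hΩ hg

/-- The surface measure on `∂Ω`: the `(n-1)`-dimensional Hausdorff measure (up to a positive
normalizing constant depending only on `n`) restricted to the boundary. -/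
noncomputable def surfaceMeasure {n : ℕ} (Ω : Set (Euc n)) : Measure (Euc n) :=
  (Measure.hausdorffMeasure ((n : ℝ) - 1)).restrict (frontier Ω)

/-- `v|_{∂Ω} = f` in the sense of traces, for `v ∈ W^{1,2}(Ω)`. The trace operator
`W^{1,2}(Ω) → L²(∂Ω)` is the continuous extension of `w ↦ w|_{∂Ω}` from the (dense) class of
functions that are `C¹` up to the boundary; so `f` is the trace of `v` if there are `C¹` functions
`w k` on `ℝⁿ` with `w k → v` in `W^{1,2}(Ω)` and `w k|_{∂Ω} → f` in `L²(∂Ω)`. -/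
def HasTrace {n : ℕ} (Ω : Set (Euc n)) (v : Lp ℝ 2 (volume.restrict Ω)) (f : Euc n → ℝ) : Prop :=
  v ∈ W12 Ω ∧ ∃ w : ℕ → Euc n → ℝ, (∀ k, ContDiff ℝ 1 (w k)) ∧
    Tendsto (fun k => eLpNorm (fun x => w k x - v x) 2 (volume.restrict Ω)) atTop (𝓝 0) ∧
    Tendsto (fun k => eLpNorm (fun x => gradient (w k) x - weakGradient Ω v x) 2
      (volume.restrict Ω)) atTop (𝓝 0) ∧
    Tendsto (fun k => eLpNorm (fun x => w k x - f x) 2 (surfaceMeasure Ω)) atTop (𝓝 0)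

/-- The admissible class `{v ∈ W^{1,2}(Ω) : v|_{∂Ω} = f, v ≥ φ}`, with `v ≥ φ` a.e. in `Ω`. -/
def obstacleClass {n : ℕ} (Ω : Set (Euc n)) (φ f : Euc n → ℝ) :
    Set (Lp ℝ 2 (volume.restrict Ω)) :=
  {v | v ∈ W12 Ω ∧ HasTrace Ω v f ∧ ∀ᵐ x ∂(volume.restrict Ω), φ x ≤ v x}

/-- The Dirichlet energy `∫_Ω |∇v|² / 2`. -/
noncomputable def dirichletEnergy {n : ℕ} (Ω : Set (Euc n)) (v : Lp ℝ 2 (volume.restrict Ω)) : ℝ :=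
  ∫ x in Ω, ‖weakGradient Ω v x‖ ^ 2 / 2

/-! The energy of `v` is half the squared `L²` norm of its weak gradient, so minimizing it over the
obstacle class means projecting `0` onto the set of gradients of admissible functions. In a Hilbert
space this works once that set is nonempty, convex and complete.

Completeness rests on Friedrichs' inequality `‖v‖ ≤ C ‖∇v‖` for zero trace (`HasTrace.friedrichs`).
Applied to differences of admissible functions, it turns convergence of gradients into convergence
in `W^{1,2}`, under which weak gradient, trace and obstacle constraint all persist
(`mem_obstacleClass_of_tendsto`). It also shows that the minimizing gradient determines the
function, hence uniqueness. The inequality is proved for `C¹` functions by integrating along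
parallel rays up to the boundary, and needs only a bounded open set.

The regularity of `∂Ω`, `φ` and `f` serves for nonemptiness
(`IsBoundedC1Domain.exists_contDiff_admissible`): near the boundary, extend `f` constantly in the
vertical direction and add a multiple of the height above the graph that outgrows `φ`; then glue by
a partition of unity. -/

/-! ### Weak gradients: linearity, closedness, and the classical case. -/

section WeakGradient

section Gradient

variable {E : Type*} [NormedAddCommGroup E] [InnerProductSpace ℝ E] [CompleteSpace E]

theorem ContDiff.continuous_gradient {w : E → ℝ} (hw : ContDiff ℝ 1 w) :
    Continuous (gradient w) :=
  (InnerProductSpace.toDual ℝ E).symm.continuous.comp (hw.continuous_fderiv one_ne_zero)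

theorem HasCompactSupport.gradient {w : E → ℝ} (hw : HasCompactSupport w) :
    HasCompactSupport (gradient w) :=
  (hw.fderiv ℝ).comp_left (g := (InnerProductSpace.toDual ℝ E).symm) (map_zero _)

theorem gradient_linearCombination {w w' : E → ℝ} (hw : Differentiable ℝ w)
    (hw' : Differentiable ℝ w') (a b : ℝ) (x : E) :
    gradient (fun y => a * w y + b * w' y) x = a • gradient w x + b • gradient w' x := by
  refine ext_inner_right ℝ fun e => ?_
  have h := (((hw x).hasFDerivAt.const_mul a).add ((hw' x).hasFDerivAt.const_mul b)).fderiv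
  rw [inner_gradient_left, inner_add_left, inner_smul_left, inner_smul_left, inner_gradient_left,
    inner_gradient_left]
  have h' : fderiv ℝ (fun y => a * w y + b * w' y) x = a • fderiv ℝ w x + b • fderiv ℝ w' x := h
  simp [h']

end Gradient

variable {n : ℕ} {Ω : Set (Euc n)}

/-- Being a weak gradient is orthogonality of `(u, g)` to pairs `(a, b)` that depend only on `ψ` and
`e`. Linearity and closedness of the graph follow from this form; `Lp.ext` identifies the pairs
supplied for different `(u, g)`. -/
theorem hasWeakGradient_iff_inner {u : Lp ℝ 2 (volume.restrict Ω)}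
    {g : Lp (Euc n) 2 (volume.restrict Ω)} :
    HasWeakGradient Ω u g ↔ ∀ ψ : Euc n → ℝ, ContDiff ℝ ∞ ψ → HasCompactSupport ψ →
      tsupport ψ ⊆ Ω → ∀ e : Euc n, ∃ (a : Lp ℝ 2 (volume.restrict Ω))
        (b : Lp (Euc n) 2 (volume.restrict Ω)),
        (a =ᵐ[volume.restrict Ω] fun x => inner ℝ e (gradient ψ x)) ∧
        (b =ᵐ[volume.restrict Ω] fun x => ψ x • e) ∧ inner ℝ u a + inner ℝ g b = 0 := by
  have key : ∀ (ψ : Euc n → ℝ) (hψ : ContDiff ℝ ∞ ψ) (hc : HasCompactSupport ψ) (e : Euc n)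
      (a : Lp ℝ 2 (volume.restrict Ω)) (b : Lp (Euc n) 2 (volume.restrict Ω))
      (_ : a =ᵐ[volume.restrict Ω] fun x => inner ℝ e (gradient ψ x))
      (_ : b =ᵐ[volume.restrict Ω] fun x => ψ x • e),
      inner ℝ u a + inner ℝ g b =
        inner ℝ e ((∫ x in Ω, u x • gradient ψ x) + ∫ x in Ω, ψ x • g x) := by
    intro ψ hψ hc e a b ha hb
    have hcg : Continuous (gradient ψ) := (hψ.of_le (by simp)).continuous_gradient
    have h1 : Integrable (fun x => u x • gradient ψ x) (volume.restrict Ω) :=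
      ((Lp.memLp u).locallyIntegrable (by norm_num)).integrable_smul_right_of_hasCompactSupport
        hcg hc.gradient
    have h2 : Integrable (fun x => ψ x • g x) (volume.restrict Ω) :=
      ((Lp.memLp g).locallyIntegrable (by norm_num)).integrable_smul_left_of_hasCompactSupport
        hψ.continuous hc
    rw [inner_add_right, ← integral_inner h1, ← integral_inner h2, L2.inner_def, L2.inner_def]
    congr 1
    · refine integral_congr_ae ?_
      filter_upwards [ha] with x hx
      rw [hx, inner_smul_right]
      simp [mul_comm]
    · refine integral_congr_ae ?_
      filter_upwards [hb] with x hx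
      rw [hx, inner_smul_right, inner_smul_right, real_inner_comm]
  constructor
  · intro h ψ hψ hc hs e
    have hcg : Continuous (gradient ψ) := (hψ.of_le (by simp)).continuous_gradient
    have ha : MemLp (fun x => (inner ℝ e (gradient ψ x) : ℝ)) 2 (volume.restrict Ω) :=
      (hcg.memLp_of_hasCompactSupport hc.gradient).const_inner e
    have hb : MemLp (fun x => ψ x • e) 2 (volume.restrict Ω) :=
      (hψ.continuous.smul continuous_const).memLp_of_hasCompactSupport (hc.smul_right)
    refine ⟨ha.toLp, hb.toLp, ha.coeFn_toLp, hb.coeFn_toLp, ?_⟩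
    rw [key ψ hψ hc e _ _ ha.coeFn_toLp hb.coeFn_toLp, h ψ hψ hc hs]
    simp
  · intro h ψ hψ hc hs
    refine eq_neg_of_add_eq_zero_left (ext_inner_left ℝ fun e => ?_)
    obtain ⟨a, b, ha, hb, hab⟩ := h ψ hψ hc hs e
    rw [← key ψ hψ hc e a b ha hb, hab, inner_zero_right]

/-- The graph of the weak gradient, as a subspace of `L²(Ω) × L²(Ω; ℝⁿ)`. -/
def weakGradientGraph (Ω : Set (Euc n)) :
    Submodule ℝ (Lp ℝ 2 (volume.restrict Ω) × Lp (Euc n) 2 (volume.restrict Ω)) where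
  carrier := {p | HasWeakGradient Ω p.1 p.2}
  zero_mem' := by
    intro ψ _ _ _
    have h1 : ∀ᵐ x ∂(volume.restrict Ω), (0 : Lp ℝ 2 (volume.restrict Ω)) x = 0 :=
      Lp.coeFn_zero _ _ _
    have h2 : ∀ᵐ x ∂(volume.restrict Ω), (0 : Lp (Euc n) 2 (volume.restrict Ω)) x = 0 :=
      Lp.coeFn_zero _ _ _
    rw [integral_eq_zero_of_ae, integral_eq_zero_of_ae, neg_zero]
    · filter_upwards [h2] with x hx
      exact (congrArg (ψ x • ·) hx).trans (smul_zero _)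
    · filter_upwards [h1] with x hx
      exact (congrArg (· • gradient ψ x) hx).trans (zero_smul _ _)
  add_mem' := by
    intro p q hp hq
    refine hasWeakGradient_iff_inner.2 fun ψ hψ hc hs e => ?_
    obtain ⟨a, b, ha, hb, h⟩ := hasWeakGradient_iff_inner.1 hp ψ hψ hc hs e
    obtain ⟨a', b', ha', hb', h'⟩ := hasWeakGradient_iff_inner.1 hq ψ hψ hc hs e
    obtain rfl : a = a' := Lp.ext (ha.trans ha'.symm)
    obtain rfl : b = b' := Lp.ext (hb.trans hb'.symm)
    refine ⟨a, b, ha, hb, ?_⟩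
    rw [Prod.fst_add, Prod.snd_add, inner_add_left, inner_add_left]
    linarith
  smul_mem' := by
    intro c p hp
    refine hasWeakGradient_iff_inner.2 fun ψ hψ hc hs e => ?_
    obtain ⟨a, b, ha, hb, h⟩ := hasWeakGradient_iff_inner.1 hp ψ hψ hc hs e
    refine ⟨a, b, ha, hb, ?_⟩
    rw [Prod.smul_fst, Prod.smul_snd, inner_smul_left, inner_smul_left, ← mul_add, h, mul_zero]

theorem mem_weakGradientGraph {p : Lp ℝ 2 (volume.restrict Ω) × Lp (Euc n) 2 (volume.restrict Ω)} :
    p ∈ weakGradientGraph Ω ↔ HasWeakGradient Ω p.1 p.2 := Iff.rfl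

theorem isClosed_weakGradientGraph :
    IsClosed (weakGradientGraph Ω :
      Set (Lp ℝ 2 (volume.restrict Ω) × Lp (Euc n) 2 (volume.restrict Ω))) := by
  refine isClosed_of_closure_subset fun p hp => ?_
  obtain ⟨q, hq, hqp⟩ := mem_closure_iff_seq_limit.1 hp
  refine hasWeakGradient_iff_inner.2 fun ψ hψ hc hs e => ?_
  obtain ⟨a, b, ha, hb, -⟩ := hasWeakGradient_iff_inner.1 (hq 0) ψ hψ hc hs e
  refine ⟨a, b, ha, hb, ?_⟩
  have hlim : Tendsto (fun k => (inner ℝ (q k).1 a + inner ℝ (q k).2 b : ℝ)) atTop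
      (𝓝 (inner ℝ p.1 a + inner ℝ p.2 b)) :=
    ((((continuous_fst.tendsto p).comp hqp).inner tendsto_const_nhds).add
      (((continuous_snd.tendsto p).comp hqp).inner tendsto_const_nhds))
  refine tendsto_nhds_unique hlim (tendsto_const_nhds.congr fun k => ?_)
  obtain ⟨a', b', ha', hb', h'⟩ := hasWeakGradient_iff_inner.1 (hq k) ψ hψ hc hs e
  obtain rfl : a = a' := Lp.ext (ha.trans ha'.symm)
  obtain rfl : b = b' := Lp.ext (hb.trans hb'.symm)
  exact h'.symm

theorem HasWeakGradient.linearCombination {u v : Lp ℝ 2 (volume.restrict Ω)}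
    {g h : Lp (Euc n) 2 (volume.restrict Ω)} (hu : HasWeakGradient Ω u g)
    (hv : HasWeakGradient Ω v h) (a b : ℝ) :
    HasWeakGradient Ω (a • u + b • v : Lp ℝ 2 (volume.restrict Ω))
      (a • g + b • h : Lp (Euc n) 2 (volume.restrict Ω)) :=
  (weakGradientGraph Ω).add_mem ((weakGradientGraph Ω).smul_mem a (x := (u, g)) hu)
    ((weakGradientGraph Ω).smul_mem b (x := (v, h)) hv)

theorem weakGradient_linearCombination (hΩ : IsOpen Ω) {u v : Lp ℝ 2 (volume.restrict Ω)}
    (hu : u ∈ W12 Ω) (hv : v ∈ W12 Ω) (a b : ℝ) :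
    weakGradient Ω (a • u + b • v) = a • weakGradient Ω u + b • weakGradient Ω v :=
  ((hasWeakGradient_weakGradient hu).linearCombination (hasWeakGradient_weakGradient hv)
    a b).weakGradient_eq hΩ

/-- A `C¹` function has its classical gradient as weak gradient. -/
theorem ContDiff.hasWeakGradient {w : Euc n → ℝ} (hw : ContDiff ℝ 1 w) :
    HasWeakGradient Ω w (gradient w) := by
  intro ψ hψ hc hs
  have hψ1 : ContDiff ℝ 1 ψ := hψ.of_le (by simp)
  have hsub : ∀ x, x ∉ Ω → ψ x = 0 := fun x hx => image_eq_zero_of_notMem_tsupport fun h => hx (hs h)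
  have hsubg : ∀ x, x ∉ Ω → gradient ψ x = 0 := by
    intro x hx
    have : fderiv ℝ ψ x = 0 := fderiv_of_notMem_tsupport ℝ fun h => hx (hs h)
    simp [gradient, this]
  rw [setIntegral_eq_integral_of_forall_compl_eq_zero (fun x hx => by rw [hsubg x hx, smul_zero]),
    setIntegral_eq_integral_of_forall_compl_eq_zero (fun x hx => by rw [hsub x hx, zero_smul])]
  have hi1 : Integrable (fun x => w x • gradient ψ x) :=
    (hw.continuous.smul hψ1.continuous_gradient).integrable_of_hasCompactSupport
      hc.gradient.smul_left
  have hi2 : Integrable (fun x => ψ x • gradient w x) :=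
    (hψ.continuous.smul hw.continuous_gradient).integrable_of_hasCompactSupport hc.smul_right
  refine ext_inner_left ℝ fun e => ?_
  rw [inner_neg_right, ← integral_inner hi1, ← integral_inner hi2]
  have hcg : ∀ {f : Euc n → ℝ}, ContDiff ℝ 1 f → Continuous fun x => fderiv ℝ f x e := fun hf =>
    (hf.continuous_fderiv one_ne_zero).clm_apply continuous_const
  have h := integral_mul_fderiv_eq_neg_fderiv_mul_of_integrable (μ := volume) (f := w) (g := ψ)
    (v := e)
    (((hcg hw).mul hψ.continuous).integrable_of_hasCompactSupport hc.mul_left)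
    ((hw.continuous.mul (hcg hψ1)).integrable_of_hasCompactSupport
      ((hc.fderiv_apply (𝕜 := ℝ) e).mul_left))
    ((hw.continuous.mul hψ.continuous).integrable_of_hasCompactSupport hc.mul_left)
    (fun x _ => (hw.differentiable one_ne_zero) x) (fun x _ => (hψ1.differentiable one_ne_zero) x)
  simp only [inner_smul_right, inner_gradient_right]
  simpa [mul_comm] using h

theorem Continuous.memLp_restrict_of_isBounded {F : Type*} [NormedAddCommGroup F]
    {w : Euc n → F} (hw : Continuous w) (hb : Bornology.IsBounded Ω) (p : ℝ≥0∞) :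
    MemLp w p (volume.restrict Ω) := by
  have hK : IsCompact (closure Ω) := hb.isCompact_closure
  have : IsFiniteMeasure (volume.restrict (closure Ω)) := ⟨by simpa using hK.measure_lt_top⟩
  obtain ⟨C, hC⟩ := hK.exists_bound_of_continuousOn hw.continuousOn
  refine MemLp.mono_measure (Measure.restrict_mono subset_closure le_rfl)
    (MemLp.of_bound hw.aestronglyMeasurable C ?_)
  filter_upwards [ae_restrict_mem isClosed_closure.measurableSet] with x hx using hC x hx

end WeakGradient

/-! ### Friedrichs' inequality for `C¹` functions, by integration along rays. -/

section Friedrichs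

theorem ENNReal.add_sq_le_two_mul (a b : ℝ≥0∞) : (a + b) ^ 2 ≤ 2 * (a ^ 2 + b ^ 2) := by
  have h := ENNReal.rpow_add_le_mul_rpow_add_rpow a b (p := 2) (by norm_num)
  norm_num at h
  exact_mod_cast h

theorem lintegral_sq_le_measure_univ_mul {α : Type*} [MeasurableSpace α] {μ : Measure α}
    {g : α → ℝ≥0∞} (hg : AEMeasurable g μ) :
    (∫⁻ a, g a ∂μ) ^ 2 ≤ μ Set.univ * ∫⁻ a, g a ^ 2 ∂μ := by
  have h := ENNReal.lintegral_mul_le_Lp_mul_Lq μ Real.HolderConjugate.two_two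
    (aemeasurable_const (b := (1 : ℝ≥0∞))) hg
  simp only [Pi.mul_apply, one_mul, ENNReal.rpow_two, one_pow, lintegral_one] at h
  refine (pow_le_pow_left₀ zero_le h 2).trans (le_of_eq ?_)
  rw [mul_pow, ← ENNReal.rpow_mul_natCast, ← ENNReal.rpow_mul_natCast]
  norm_num

section ExitTime

variable {E : Type*} [NormedAddCommGroup E] [NormedSpace ℝ E]

/-- The first time at which the ray `x - s • v` is outside `Ω`. -/
noncomputable def exitTime (Ω : Set E) (v x : E) : ℝ := sInf {s : ℝ | 0 ≤ s ∧ x - s • v ∉ Ω}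

theorem bddBelow_exitTime (Ω : Set E) (v x : E) : BddBelow {s : ℝ | 0 ≤ s ∧ x - s • v ∉ Ω} :=
  ⟨0, fun _ hs => hs.1⟩

variable {Ω : Set E} {v : E} {R : ℝ}

theorem exitTime_lt_mem {x : E} {t : ℝ} (ht : 0 ≤ t) (h : t < exitTime Ω v x) :
    x - t • v ∈ Ω := by
  by_contra hx
  exact absurd (csInf_le (bddBelow_exitTime Ω v x) ⟨ht, hx⟩) (not_le.2 h)

/-- The set of outside times is closed as `Ω` is open, and nonempty (it contains `R` or `0`), so the
infimum is attained and the default value of `sInf ∅` never enters. -/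
theorem exitTime_mem (hΩ : IsOpen Ω) (hR : 0 ≤ R) (hRv : ∀ x ∈ Ω, x - R • v ∉ Ω) (x : E) :
    0 ≤ exitTime Ω v x ∧ x - exitTime Ω v x • v ∉ Ω := by
  have hcl : IsClosed {s : ℝ | 0 ≤ s ∧ x - s • v ∉ Ω} :=
    isClosed_Ici.inter (hΩ.isClosed_compl.preimage (by fun_prop : Continuous fun s : ℝ => x - s • v))
  refine hcl.csInf_mem ?_ (bddBelow_exitTime _ _ _)
  by_cases hx : x ∈ Ω
  · exact ⟨R, hR, hRv x hx⟩
  · exact ⟨0, le_rfl, by simpa using hx⟩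

theorem exitTime_le (hR : 0 ≤ R) (hRv : ∀ x ∈ Ω, x - R • v ∉ Ω) (x : E) :
    exitTime Ω v x ≤ R := by
  by_cases hx : x ∈ Ω
  · exact csInf_le (bddBelow_exitTime _ _ _) ⟨hR, hRv x hx⟩
  · exact (csInf_le (bddBelow_exitTime _ _ _) ⟨le_rfl, by simpa using hx⟩).trans hR

theorem exitTime_pos (hΩ : IsOpen Ω) (hR : 0 ≤ R) (hRv : ∀ x ∈ Ω, x - R • v ∉ Ω) {x : E}
    (hx : x ∈ Ω) : 0 < exitTime Ω v x := by
  obtain ⟨h0, h1⟩ := exitTime_mem hΩ hR hRv x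
  refine h0.lt_of_ne fun h => h1 ?_
  rwa [← h, zero_smul, sub_zero]

-- The sublevel set at `c` is the sum of the closed set `Ωᶜ` and a compact segment, hence closed.
open scoped Pointwise in
theorem measurable_exitTime [MeasurableSpace E] [BorelSpace E] (hΩ : IsOpen Ω) (hR : 0 ≤ R)
    (hRv : ∀ x ∈ Ω, x - R • v ∉ Ω) : Measurable (exitTime Ω v) := by
  refine measurable_of_Iic fun c => IsClosed.measurableSet ?_
  have : exitTime Ω v ⁻¹' Set.Iic c = Ωᶜ + (fun s : ℝ => s • v) '' Set.Icc 0 c := by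
    ext x
    simp only [Set.mem_preimage, Set.mem_Iic, Set.mem_add, Set.mem_image]
    constructor
    · intro h
      obtain ⟨h0, h1⟩ := exitTime_mem hΩ hR hRv x
      exact ⟨_, h1, _, ⟨_, ⟨h0, h⟩, rfl⟩, by abel⟩
    · rintro ⟨y, hy, _, ⟨s, hs, rfl⟩, rfl⟩
      exact (csInf_le (bddBelow_exitTime _ _ _) ⟨hs.1, by simpa using hy⟩).trans hs.2
  rw [this]
  exact hΩ.isClosed_compl.add_right_of_isCompact (isCompact_Icc.image (by fun_prop))

theorem exit_point_mem_frontier (hΩ : IsOpen Ω) (hR : 0 ≤ R) (hRv : ∀ x ∈ Ω, x - R • v ∉ Ω)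
    {x : E} (hx : x ∈ Ω) : x - exitTime Ω v x • v ∈ frontier Ω := by
  rw [hΩ.frontier_eq]
  refine ⟨?_, (exitTime_mem hΩ hR hRv x).2⟩
  have hpos := exitTime_pos hΩ hR hRv hx
  have hlim : Tendsto (fun t : ℝ => x - t • v) (𝓝[<] exitTime Ω v x)
      (𝓝 (x - exitTime Ω v x • v)) :=
    ((by fun_prop : Continuous fun t : ℝ => x - t • v).tendsto _).mono_left nhdsWithin_le_nhds
  refine mem_closure_of_tendsto hlim ?_
  filter_upwards [Ioo_mem_nhdsLT hpos] with t ht using exitTime_lt_mem ht.1.le ht.2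

end ExitTime

/-- Fundamental theorem of calculus from `x` to its exit point, then Cauchy–Schwarz in `t`. The
integral is enlarged to the fixed interval `(0, R]`, with the gradient cut off outside `Ω`, so that
Tonelli applies when `x` varies. -/
theorem enorm_sq_le_exit_point {E : Type*} [NormedAddCommGroup E] [InnerProductSpace ℝ E]
    [CompleteSpace E] [MeasurableSpace E] [BorelSpace E] {Ω : Set E} {v : E} {R : ℝ}
    (hΩ : IsOpen Ω) (hR : 0 ≤ R) (hRv : ∀ x ∈ Ω, x - R • v ∉ Ω) (hv : ‖v‖ = 1) {w : E → ℝ}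
    (hw : ContDiff ℝ 1 w) (x : E) :
    ‖w x‖ₑ ^ 2 ≤ 2 * (‖w (x - exitTime Ω v x • v)‖ₑ ^ 2 + ENNReal.ofReal R *
      ∫⁻ t in Set.Ioc 0 R, Ω.indicator (fun y => ‖gradient w y‖ₑ ^ 2) (x - t • v)) := by
  set s := exitTime Ω v x with hs
  have hs0 : 0 ≤ s := (exitTime_mem hΩ hR hRv x).1
  have hsR : s ≤ R := exitTime_le hR hRv x
  have hline : Continuous fun t : ℝ => x - t • v := by fun_prop
  have hd : ∀ t : ℝ, HasDerivAt (fun t : ℝ => w (x - t • v))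
      (-(inner ℝ (gradient w (x - t • v)) v)) t := by
    intro t
    have h1 : HasDerivAt (fun t : ℝ => x - t • v) (-v) t := by
      simpa using ((hasDerivAt_id t).smul_const v).const_sub x
    have h2 := ((hw.differentiable one_ne_zero) (x - t • v)).hasFDerivAt.comp_hasDerivAt t h1
    rw [inner_gradient_left, ← map_neg]
    exact h2
  have hcont : Continuous fun t : ℝ => -(inner ℝ (gradient w (x - t • v)) v : ℝ) :=
    ((hw.continuous_gradient.comp hline).inner continuous_const).neg
  have hftc := intervalIntegral.integral_eq_sub_of_hasDerivAt (a := 0) (b := s)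
    (fun t _ => hd t) (hcont.intervalIntegrable _ _)
  rw [intervalIntegral.integral_of_le hs0, zero_smul, sub_zero] at hftc
  set G : E → ℝ≥0∞ := Ω.indicator (fun y => ‖gradient w y‖ₑ) with hG
  have hGm : Measurable fun t : ℝ => G (x - t • v) :=
    (hw.continuous_gradient.enorm.measurable.indicator hΩ.measurableSet).comp hline.measurable
  have hle : ‖w (x - s • v) - w x‖ₑ ≤ ∫⁻ t in Set.Ioc 0 R, G (x - t • v) := by
    rw [← hftc]
    refine (enorm_integral_le_lintegral_enorm _).trans ?_
    -- The endpoint `t = s` has to be dropped: the exit point is outside `Ω`, where `G` vanishes.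
    rw [← restrict_Ioo_eq_restrict_Ioc]
    refine (setLIntegral_mono hGm fun t ht => ?_).trans
      (lintegral_mono_set (Set.Ioo_subset_Ioc_self.trans (Set.Ioc_subset_Ioc_right hsR)))
    rw [hG, Set.indicator_of_mem (exitTime_lt_mem ht.1.le ht.2), enorm_neg, enorm_le_iff_norm_le]
    simpa [hv] using norm_inner_le_norm (𝕜 := ℝ) (gradient w (x - t • v)) v
  have hsq : (∫⁻ t in Set.Ioc 0 R, G (x - t • v)) ^ 2 ≤ ENNReal.ofReal R *
      ∫⁻ t in Set.Ioc 0 R, Ω.indicator (fun y => ‖gradient w y‖ₑ ^ 2) (x - t • v) := by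
    refine (lintegral_sq_le_measure_univ_mul hGm.aemeasurable).trans (le_of_eq ?_)
    rw [Measure.restrict_apply_univ, Real.volume_Ioc, sub_zero]
    congr 2
    ext t
    by_cases ht : x - t • v ∈ Ω <;> simp [hG, ht]
  have htri : ‖w x‖ₑ ≤ ‖w (x - s • v)‖ₑ + ‖w (x - s • v) - w x‖ₑ := by
    calc ‖w x‖ₑ = ‖w (x - s • v) - (w (x - s • v) - w x)‖ₑ := by rw [sub_sub_cancel]
      _ ≤ _ := enorm_sub_le
  calc ‖w x‖ₑ ^ 2 ≤ (‖w (x - s • v)‖ₑ + ‖w (x - s • v) - w x‖ₑ) ^ 2 := by gcongr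
    _ ≤ 2 * (‖w (x - s • v)‖ₑ ^ 2 + ‖w (x - s • v) - w x‖ₑ ^ 2) := ENNReal.add_sq_le_two_mul _ _
    _ ≤ _ := by
      gcongr
      exact (pow_le_pow_left₀ zero_le hle 2).trans hsq

/-- Tonelli, then translation invariance of Lebesgue measure for each fixed `t`. -/
theorem lintegral_lintegral_line_le {m : ℕ} {Ω : Set (Euc m)} {g : Euc m → ℝ≥0∞}
    (hg : Measurable g) (v : Euc m) (R : ℝ) :
    ∫⁻ x in Ω, ∫⁻ t in Set.Ioc 0 R, g (x - t • v) ≤ ENNReal.ofReal R * ∫⁻ x, g x := by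
  have hm : Measurable (Function.uncurry fun (x : Euc m) (t : ℝ) => g (x - t • v)) :=
    hg.comp (by fun_prop : Continuous fun p : Euc m × ℝ => p.1 - p.2 • v).measurable
  rw [lintegral_lintegral_swap hm.aemeasurable]
  calc ∫⁻ t in Set.Ioc 0 R, ∫⁻ x in Ω, g (x - t • v)
      ≤ ∫⁻ _ in Set.Ioc 0 R, ∫⁻ x, g x := by
        refine lintegral_mono fun t => (setLIntegral_le_lintegral _ _).trans ?_
        rw [lintegral_sub_right_eq_self]
    _ = _ := by simp [mul_comm]

section Projection

variable {m : ℕ}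

/-- No measurability is asked of `B`: it will be the projection of a Borel subset of the boundary.
-/
theorem volume_cylinder (I : Set ℝ) (B : Set (Fin m → ℝ)) :
    volume {x : Euc (m + 1) | x 0 ∈ I ∧ (fun i : Fin m => x i.succ) ∈ B} = volume I * volume B := by
  have h1 := volume_preserving_piFinSuccAbove (fun _ : Fin (m + 1) => ℝ) 0
  have h2 := EuclideanSpace.volume_preserving_symm_measurableEquiv_toLp (Fin (m + 1))
  have h3 := h2.measure_preimage_equiv
    (MeasurableEquiv.piFinSuccAbove (fun _ : Fin (m + 1) => ℝ) 0 ⁻¹' (I ×ˢ B))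
  rw [h1.measure_preimage_equiv, Measure.volume_eq_prod, Measure.prod_prod] at h3
  rw [← h3]
  rfl

/-- Dropping a coordinate is 1-Lipschitz from the Euclidean to the sup norm, so it does not increase
`m`-dimensional Hausdorff measure, which for the sup norm on `Fin m → ℝ` is Lebesgue measure. -/
theorem volume_image_tail_le (S : Set (Euc (m + 1))) :
    volume ((fun x : Euc (m + 1) => fun i : Fin m => x i.succ) '' S) ≤
      (Measure.hausdorffMeasure (((m + 1 : ℕ) : ℝ) - 1) : Measure (Euc (m + 1))) S := by
  have hL : LipschitzWith 1 (fun x : Euc (m + 1) => fun i : Fin m => x i.succ) := by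
    refine LipschitzWith.of_dist_le_mul fun x y => ?_
    rw [NNReal.coe_one, one_mul, dist_pi_le_iff dist_nonneg]
    intro i
    rw [dist_eq_norm, dist_eq_norm]
    exact PiLp.norm_apply_le (x - y) i.succ
  have h := hL.hausdorffMeasure_image_le (Nat.cast_nonneg (α := ℝ) m) S
  have hpi := hausdorffMeasure_pi_real (ι := Fin m)
  rw [Fintype.card_fin] at hpi
  rw [hpi] at h
  simpa using h

end Projection

variable {m : ℕ} {Ω : Set (Euc (m + 1))}

/-- Points of `Ω` exiting through `S` lie in a cylinder of height `2ρ` over the projection of `S ∩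
∂Ω` along the ray direction. -/
theorem map_exit_point_le {R ρ : ℝ} (hΩ : IsOpen Ω) (hR : 0 ≤ R)
    (hRv : ∀ x ∈ Ω, x - R • EuclideanSpace.single (0 : Fin (m + 1)) (1 : ℝ) ∉ Ω)
    (hρ : ∀ x ∈ Ω, ‖x‖ ≤ ρ) :
    (volume.restrict Ω).map (fun x => x - exitTime Ω (EuclideanSpace.single 0 1) x •
      EuclideanSpace.single (0 : Fin (m + 1)) (1 : ℝ)) ≤
      ENNReal.ofReal (2 * ρ) • surfaceMeasure Ω := by
  have hmeas : Measurable (fun x => x - exitTime Ω (EuclideanSpace.single 0 1) x •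
      EuclideanSpace.single (0 : Fin (m + 1)) (1 : ℝ)) :=
    measurable_id.sub ((measurable_exitTime hΩ hR hRv).smul_const _)
  refine Measure.le_iff.2 fun S hS => ?_
  rw [Measure.map_apply hmeas hS, Measure.restrict_apply (hmeas hS), Measure.smul_apply,
    surfaceMeasure, Measure.restrict_apply hS, smul_eq_mul]
  calc volume ((fun x => x - exitTime Ω (EuclideanSpace.single 0 1) x •
        EuclideanSpace.single (0 : Fin (m + 1)) (1 : ℝ)) ⁻¹' S ∩ Ω)
      ≤ volume {x : Euc (m + 1) | x 0 ∈ Set.Icc (-ρ) ρ ∧ (fun i : Fin m => x i.succ) ∈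
          (fun x : Euc (m + 1) => fun i : Fin m => x i.succ) '' (S ∩ frontier Ω)} := by
        refine measure_mono fun x hx => ⟨?_, ?_⟩
        · exact abs_le.1 ((PiLp.norm_apply_le x 0).trans (hρ x hx.2))
        · refine ⟨_, ⟨hx.1, exit_point_mem_frontier hΩ hR hRv hx.2⟩, ?_⟩
          ext i
          simp
    _ ≤ _ := by
      rw [volume_cylinder, Real.volume_Icc, sub_neg_eq_add, ← two_mul]
      gcongr
      exact volume_image_tail_le _

/-- **Friedrichs' inequality**: on a bounded open set, the `L²` norm of a `C¹` function is
controlled by those of its gradient and of its boundary values. -/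
theorem friedrichs_lintegral (hΩ : IsOpen Ω) (hb : Bornology.IsBounded Ω) :
    ∃ C : NNReal, ∀ w : Euc (m + 1) → ℝ, ContDiff ℝ 1 w →
      ∫⁻ x in Ω, ‖w x‖ₑ ^ 2 ≤ C * ((∫⁻ x in Ω, ‖gradient w x‖ₑ ^ 2) +
        ∫⁻ x, ‖w x‖ₑ ^ 2 ∂surfaceMeasure Ω) := by
  obtain ⟨ρ, hρ0, hρ⟩ := hb.exists_pos_norm_le
  set v : Euc (m + 1) := EuclideanSpace.single (0 : Fin (m + 1)) (1 : ℝ) with hv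
  have hv1 : ‖v‖ = 1 := by simp [hv]
  -- Longer than the diameter of `Ω`, so every ray starting in `Ω` is outside at time `R`.
  set R : ℝ := 2 * ρ + 1 with hRdef
  have hR : 0 ≤ R := by positivity
  have hRv : ∀ x ∈ Ω, x - R • v ∉ Ω := by
    intro x hx hx'
    have h := norm_sub_le x (x - R • v)
    rw [sub_sub_cancel, norm_smul, hv1, mul_one, Real.norm_of_nonneg hR] at h
    linarith [hρ x hx, hρ _ hx']
  refine ⟨2 * (Real.toNNReal (2 * ρ) + Real.toNNReal R * Real.toNNReal R), fun w hw => ?_⟩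
  set b : Euc (m + 1) → Euc (m + 1) := fun x => x - exitTime Ω v x • v with hbdef
  have hbm : Measurable b := measurable_id.sub ((measurable_exitTime hΩ hR hRv).smul_const _)
  have hwm : Measurable fun x => ‖w x‖ₑ ^ 2 := (hw.continuous.enorm.measurable).pow_const 2
  have hgm : Measurable fun x => ‖gradient w x‖ₑ ^ 2 :=
    (hw.continuous_gradient.enorm.measurable).pow_const 2
  have hB : ∫⁻ x in Ω, ‖w (b x)‖ₑ ^ 2 ≤
      ENNReal.ofReal (2 * ρ) * ∫⁻ x, ‖w x‖ₑ ^ 2 ∂surfaceMeasure Ω := by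
    rw [← lintegral_map hwm hbm, ← smul_eq_mul, ← lintegral_smul_measure]
    exact lintegral_mono' (map_exit_point_le hΩ hR hRv hρ) le_rfl
  have hGr := lintegral_lintegral_line_le (Ω := Ω) (hgm.indicator hΩ.measurableSet) v R
  rw [lintegral_indicator hΩ.measurableSet] at hGr
  calc ∫⁻ x in Ω, ‖w x‖ₑ ^ 2
      ≤ ∫⁻ x in Ω, 2 * (‖w (b x)‖ₑ ^ 2 + ENNReal.ofReal R *
        ∫⁻ t in Set.Ioc 0 R, Ω.indicator (fun y => ‖gradient w y‖ₑ ^ 2) (x - t • v)) :=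
        lintegral_mono fun x => enorm_sq_le_exit_point hΩ hR hRv hv1 hw x
    _ = 2 * ((∫⁻ x in Ω, ‖w (b x)‖ₑ ^ 2) + ENNReal.ofReal R * ∫⁻ x in Ω,
        ∫⁻ t in Set.Ioc 0 R, Ω.indicator (fun y => ‖gradient w y‖ₑ ^ 2) (x - t • v)) := by
        rw [lintegral_const_mul' _ _ (by simp), lintegral_add_left (f := fun x => ‖w (b x)‖ₑ ^ 2) (hwm.comp hbm),
          lintegral_const_mul' _ _ (by simp)]
    _ ≤ 2 * ((ENNReal.ofReal (2 * ρ) * ∫⁻ x, ‖w x‖ₑ ^ 2 ∂surfaceMeasure Ω) + ENNReal.ofReal R *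
        (ENNReal.ofReal R * ∫⁻ x in Ω, ‖gradient w x‖ₑ ^ 2)) := by gcongr
    _ ≤ _ := by
      simp only [ENNReal.ofReal]
      push_cast
      rw [mul_assoc 2]
      gcongr 2 * ?_
      rw [← mul_assoc, mul_add, add_comm]
      gcongr
      · exact le_add_self
      · exact le_self_add

theorem friedrichs_eLpNorm (hΩ : IsOpen Ω) (hb : Bornology.IsBounded Ω) :
    ∃ C : NNReal, ∀ w : Euc (m + 1) → ℝ, ContDiff ℝ 1 w →
      eLpNorm w 2 (volume.restrict Ω) ≤ C * (eLpNorm (gradient w) 2 (volume.restrict Ω) +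
        eLpNorm w 2 (surfaceMeasure Ω)) := by
  obtain ⟨C, hC⟩ := friedrichs_lintegral hΩ hb
  have key : ∀ {F : Type} [NormedAddCommGroup F] (g : Euc (m + 1) → F) (μ : Measure (Euc (m + 1))),
      ∫⁻ x, ‖g x‖ₑ ^ 2 ∂μ = eLpNorm g 2 μ ^ 2 := by
    intro F _ g μ
    have := eLpNorm_nnreal_pow_eq_lintegral (f := g) (μ := μ) (p := 2) two_ne_zero
    simpa using this.symm
  refine ⟨NNReal.sqrt C, fun w hw => ?_⟩
  have h := hC w hw
  rw [key, key, key] at h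
  refine (ENNReal.pow_le_pow_left_iff two_ne_zero).1 (h.trans ?_)
  rw [mul_pow, ← ENNReal.coe_pow, NNReal.sq_sqrt]
  gcongr
  rw [add_sq, add_right_comm]
  exact le_self_add

end Friedrichs

/-! ### Traces: linearity, stability under limits, and Friedrichs' inequality for zero trace. -/

section Trace

variable {n : ℕ} {Ω : Set (Euc n)}

theorem tendsto_eLpNorm_linearCombination {α F : Type*} [MeasurableSpace α] {μ : Measure α}
    [NormedAddCommGroup F] [NormedSpace ℝ F] {p q : ℕ → α → F} {a b : ℝ}
    (hp : ∀ k, AEStronglyMeasurable (p k) μ) (hq : ∀ k, AEStronglyMeasurable (q k) μ)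
    (hp0 : Tendsto (fun k => eLpNorm (p k) 2 μ) atTop (𝓝 0))
    (hq0 : Tendsto (fun k => eLpNorm (q k) 2 μ) atTop (𝓝 0)) :
    Tendsto (fun k => eLpNorm (a • p k + b • q k) 2 μ) atTop (𝓝 0) := by
  have h := (ENNReal.Tendsto.const_mul (a := ‖a‖ₑ) hp0 (Or.inr enorm_ne_top)).add
    (ENNReal.Tendsto.const_mul (a := ‖b‖ₑ) hq0 (Or.inr enorm_ne_top))
  simp only [mul_zero, add_zero] at h
  refine tendsto_of_tendsto_of_tendsto_of_le_of_le tendsto_const_nhds h (fun _ => zero_le)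
    fun k => ?_
  refine (eLpNorm_add_le ((hp k).const_smul a) ((hq k).const_smul b) (by norm_num)).trans ?_
  rw [eLpNorm_const_smul, eLpNorm_const_smul]

theorem HasTrace.linearCombination (hΩ : IsOpen Ω) {u v : Lp ℝ 2 (volume.restrict Ω)}
    {f g : Euc n → ℝ} (hf : AEStronglyMeasurable f (surfaceMeasure Ω))
    (hg : AEStronglyMeasurable g (surfaceMeasure Ω)) (hu : HasTrace Ω u f) (hv : HasTrace Ω v g)
    (a b : ℝ) : HasTrace Ω (a • u + b • v) (fun x => a * f x + b * g x) := by
  obtain ⟨huW, w, hw, hw1, hw2, hw3⟩ := hu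
  obtain ⟨hvW, z, hz, hz1, hz2, hz3⟩ := hv
  refine ⟨⟨_, (hasWeakGradient_weakGradient huW).linearCombination
    (hasWeakGradient_weakGradient hvW) a b⟩, fun k x => a * w k x + b * z k x,
    fun k => (contDiff_const.mul (hw k)).add (contDiff_const.mul (hz k)), ?_, ?_, ?_⟩
  · refine (tendsto_eLpNorm_linearCombination (a := a) (b := b)
      (fun k => (hw k).continuous.aestronglyMeasurable.sub (Lp.aestronglyMeasurable u))
      (fun k => (hz k).continuous.aestronglyMeasurable.sub (Lp.aestronglyMeasurable v))
      hw1 hz1).congr fun k => eLpNorm_congr_ae ?_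
    filter_upwards [Lp.coeFn_add (a • u) (b • v), Lp.coeFn_smul a u, Lp.coeFn_smul b v]
      with x h1 h2 h3
    simp only [h1, Pi.add_apply, h2, h3, Pi.smul_apply, smul_eq_mul, Pi.sub_apply]
    ring
  · refine (tendsto_eLpNorm_linearCombination (a := a) (b := b)
      (fun k => (hw k).continuous_gradient.aestronglyMeasurable.sub (Lp.aestronglyMeasurable _))
      (fun k => (hz k).continuous_gradient.aestronglyMeasurable.sub (Lp.aestronglyMeasurable _))
      hw2 hz2).congr fun k => eLpNorm_congr_ae ?_
    rw [weakGradient_linearCombination hΩ huW hvW]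
    filter_upwards [Lp.coeFn_add (a • weakGradient Ω u) (b • weakGradient Ω v),
      Lp.coeFn_smul a (weakGradient Ω u), Lp.coeFn_smul b (weakGradient Ω v)] with x h1 h2 h3
    simp only [h1, Pi.add_apply, h2, h3, Pi.smul_apply, Pi.sub_apply,
      gradient_linearCombination ((hw k).differentiable one_ne_zero)
        ((hz k).differentiable one_ne_zero), smul_sub]
    abel
  · refine (tendsto_eLpNorm_linearCombination (a := a) (b := b)
      (fun k => (hw k).continuous.aestronglyMeasurable.sub hf)
      (fun k => (hz k).continuous.aestronglyMeasurable.sub hg)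
      hw3 hz3).congr fun k => eLpNorm_congr_ae (ae_of_all _ fun x => ?_)
    simp only [Pi.add_apply, Pi.smul_apply, smul_eq_mul, Pi.sub_apply]
    ring

/-- Trace conditions are stable under convergence in `W^{1,2}(Ω)`. -/
theorem HasTrace.of_tendsto (hΩ : IsOpen Ω) {v : ℕ → Lp ℝ 2 (volume.restrict Ω)}
    {u : Lp ℝ 2 (volume.restrict Ω)} {g : Lp (Euc n) 2 (volume.restrict Ω)} {f : Euc n → ℝ}
    (hv : ∀ k, HasTrace Ω (v k) f) (hvu : Tendsto v atTop (𝓝 u))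
    (hvg : Tendsto (fun k => weakGradient Ω (v k)) atTop (𝓝 g)) :
    HasTrace Ω u f ∧ weakGradient Ω u = g := by
  have hug : HasWeakGradient Ω u g :=
    mem_weakGradientGraph.1 (isClosed_weakGradientGraph.mem_of_tendsto (hvu.prodMk_nhds hvg)
      (Eventually.of_forall fun k => hasWeakGradient_weakGradient (hv k).1))
  have hgrad := hug.weakGradient_eq hΩ
  refine ⟨⟨⟨g, hug⟩, ?_⟩, hgrad⟩
  -- Diagonal choice: one `C¹` function within `1/(k+1)` of `v k` in all three norms.
  have hex : ∀ k, ∃ w : Euc n → ℝ, ContDiff ℝ 1 w ∧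
      eLpNorm (fun x => w x - v k x) 2 (volume.restrict Ω) < ((k : ℝ≥0∞) + 1)⁻¹ ∧
      eLpNorm (fun x => gradient w x - weakGradient Ω (v k) x) 2 (volume.restrict Ω) <
        ((k : ℝ≥0∞) + 1)⁻¹ ∧
      eLpNorm (fun x => w x - f x) 2 (surfaceMeasure Ω) < ((k : ℝ≥0∞) + 1)⁻¹ := by
    intro k
    obtain ⟨-, w, hw, h1, h2, h3⟩ := hv k
    have hpos : (0 : ℝ≥0∞) < ((k : ℝ≥0∞) + 1)⁻¹ := by
      rw [ENNReal.inv_pos]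
      exact ENNReal.add_ne_top.2 ⟨ENNReal.natCast_ne_top k, ENNReal.one_ne_top⟩
    obtain ⟨j, hj1, hj2, hj3⟩ := ((h1.eventually_lt_const hpos).and
      ((h2.eventually_lt_const hpos).and (h3.eventually_lt_const hpos))).exists
    exact ⟨w j, hw j, hj1, hj2, hj3⟩
  choose w hw h1 h2 h3 using hex
  have hinv : Tendsto (fun k : ℕ => ((k : ℝ≥0∞) + 1)⁻¹) atTop (𝓝 0) := by
    have := ENNReal.tendsto_inv_nat_nhds_zero.comp (tendsto_add_atTop_nat 1)
    refine this.congr fun k => ?_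
    simp
  refine ⟨w, hw, ?_, ?_, ?_⟩
  · have hlim := hinv.add ((Lp.tendsto_Lp_iff_tendsto_eLpNorm' _ _).1 hvu)
    rw [add_zero] at hlim
    refine tendsto_of_tendsto_of_tendsto_of_le_of_le tendsto_const_nhds hlim (fun _ => zero_le)
      fun k => ?_
    have heq : (fun x => w k x - u x) = (fun x => w k x - v k x) + (⇑(v k) - ⇑u) := by
      ext x
      simp
    rw [heq]
    refine (eLpNorm_add_le ((hw k).continuous.aestronglyMeasurable.sub (Lp.aestronglyMeasurable _))
      ((Lp.aestronglyMeasurable _).sub (Lp.aestronglyMeasurable _)) (by norm_num)).trans ?_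
    exact add_le_add_left (h1 k).le _
  · rw [hgrad]
    have hlim := hinv.add ((Lp.tendsto_Lp_iff_tendsto_eLpNorm' _ _).1 hvg)
    rw [add_zero] at hlim
    refine tendsto_of_tendsto_of_tendsto_of_le_of_le tendsto_const_nhds hlim (fun _ => zero_le)
      fun k => ?_
    have heq : (fun x => gradient (w k) x - g x) =
        (fun x => gradient (w k) x - weakGradient Ω (v k) x) + (⇑(weakGradient Ω (v k)) - ⇑g) := by
      ext1 x
      simp
    rw [heq]
    refine (eLpNorm_add_le
      ((hw k).continuous_gradient.aestronglyMeasurable.sub (Lp.aestronglyMeasurable _))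
      ((Lp.aestronglyMeasurable _).sub (Lp.aestronglyMeasurable _)) (by norm_num)).trans ?_
    exact add_le_add_left (h2 k).le _
  · exact tendsto_of_tendsto_of_tendsto_of_le_of_le tendsto_const_nhds hinv (fun _ => zero_le)
      fun k => (h3 k).le

theorem HasWeakGradient.congr_ae {u u' : Euc n → ℝ} {g g' : Euc n → Euc n}
    (h : HasWeakGradient Ω u g) (hu : u' =ᵐ[volume.restrict Ω] u)
    (hg : g' =ᵐ[volume.restrict Ω] g) : HasWeakGradient Ω u' g' := by
  intro ψ hψ hc hs
  rw [integral_congr_ae (hu.smul (EventuallyEq.refl _ (gradient ψ))),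
    integral_congr_ae ((EventuallyEq.refl _ ψ).smul hg)]
  exact h ψ hψ hc hs

/-- A function which is `C¹` on `ℝⁿ` has its boundary values as trace. -/
theorem ContDiff.hasTrace (hΩ : IsOpen Ω) (hb : Bornology.IsBounded Ω) {w f : Euc n → ℝ}
    (hw : ContDiff ℝ 1 w) (hwf : ∀ x ∈ frontier Ω, w x = f x) :
    HasTrace Ω ((hw.continuous.memLp_restrict_of_isBounded hb 2).toLp w) f := by
  set u := (hw.continuous.memLp_restrict_of_isBounded hb 2).toLp w
  have hu : u =ᵐ[volume.restrict Ω] w := MemLp.coeFn_toLp _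
  have hgL := hw.continuous_gradient.memLp_restrict_of_isBounded hb 2
  have hug : HasWeakGradient Ω u (hgL.toLp (gradient w)) :=
    hw.hasWeakGradient.congr_ae hu hgL.coeFn_toLp
  have hgrad : weakGradient Ω u =ᵐ[volume.restrict Ω] gradient w := by
    rw [hug.weakGradient_eq hΩ]
    exact hgL.coeFn_toLp
  have hzero : ∀ {α F : Type} [MeasurableSpace α] [NormedAddCommGroup F] {μ : Measure α}
      {h : α → F}, h =ᵐ[μ] 0 → Tendsto (fun _ : ℕ => eLpNorm h 2 μ) atTop (𝓝 0) := by
    intro α F _ _ μ h hh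
    rw [eLpNorm_congr_ae hh, eLpNorm_zero]
    exact tendsto_const_nhds
  refine ⟨⟨_, hug⟩, fun _ => w, fun _ => hw, hzero ?_, hzero ?_, hzero ?_⟩
  · filter_upwards [hu] with x hx
    simp [hx]
  · filter_upwards [hgrad] with x hx
    simp [hx]
  · filter_upwards [ae_restrict_mem isClosed_frontier.measurableSet] with x hx
    simp [hwf x hx]

/-- **Friedrichs' inequality** for Sobolev functions with zero trace. -/
theorem HasTrace.friedrichs {m : ℕ} {Ω : Set (Euc (m + 1))} (hΩ : IsOpen Ω)
    (hb : Bornology.IsBounded Ω) : ∃ C : NNReal, ∀ v : Lp ℝ 2 (volume.restrict Ω),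
      HasTrace Ω v (fun _ => 0) → ‖v‖ ≤ C * ‖weakGradient Ω v‖ := by
  obtain ⟨C, hC⟩ := friedrichs_eLpNorm hΩ hb
  refine ⟨C, fun v ⟨_, w, hw, h1, h2, h3⟩ => ?_⟩
  set g := weakGradient Ω v
  -- The `C¹` inequality for `w k` plus triangle inequalities bound `‖v‖` by this sequence, whose
  -- error terms vanish in the limit.
  have hlim := h1.add (ENNReal.Tendsto.const_mul (a := (C : ℝ≥0∞))
    ((h2.add_const (eLpNorm g 2 (volume.restrict Ω))).add h3) (Or.inr ENNReal.coe_ne_top))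
  rw [zero_add, zero_add, add_zero] at hlim
  have hle : eLpNorm v 2 (volume.restrict Ω) ≤ C * eLpNorm g 2 (volume.restrict Ω) := by
    refine ge_of_tendsto' hlim fun k => ?_
    have hwm := (hw k).continuous.aestronglyMeasurable (μ := volume.restrict Ω)
    have hgm := (hw k).continuous_gradient.aestronglyMeasurable (μ := volume.restrict Ω)
    have ha : eLpNorm v 2 (volume.restrict Ω) ≤
        eLpNorm (fun x => w k x - v x) 2 (volume.restrict Ω) +
          eLpNorm (w k) 2 (volume.restrict Ω) := by
      have heq : ⇑v = w k - fun x => w k x - v x := by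
        ext x
        simp
      conv_lhs => rw [heq]
      exact (eLpNorm_sub_le hwm (hwm.sub (Lp.aestronglyMeasurable v)) (by norm_num)).trans_eq
        (add_comm _ _)
    have hbd : eLpNorm (gradient (w k)) 2 (volume.restrict Ω) ≤
        eLpNorm (fun x => gradient (w k) x - g x) 2 (volume.restrict Ω) +
          eLpNorm g 2 (volume.restrict Ω) := by
      have heq : gradient (w k) = (fun x => gradient (w k) x - g x) + ⇑g := by
        ext1 x
        simp
      conv_lhs => rw [heq]
      exact eLpNorm_add_le (hgm.sub (Lp.aestronglyMeasurable g)) (Lp.aestronglyMeasurable g)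
        (by norm_num)
    refine ha.trans (add_le_add_right ((hC _ (hw k)).trans ?_) _)
    simp only [sub_zero]
    gcongr
  rw [Lp.norm_def, Lp.norm_def]
  have := ENNReal.toReal_mono (ENNReal.mul_ne_top ENNReal.coe_ne_top (Lp.eLpNorm_ne_top g)) hle
  simpa using this

end Trace

/-! ### Construction of an admissible `C¹` function. -/

section Admissible

variable {n : ℕ} {Ω : Set (Euc n)}

/-- `H` is the height above the graph. Its unit growth along `ν` is what the later arguments retain
of the graph structure. -/
theorem IsBoundedC1Domain.exists_defining_function (hΩ : IsBoundedC1Domain Ω) {x₀ : Euc n}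
    (hx₀ : x₀ ∈ frontier Ω) : ∃ r : ℝ, 0 < r ∧ ∃ ν : Euc n, ‖ν‖ = 1 ∧ ∃ H : Euc n → ℝ,
      ContDiff ℝ 1 H ∧ (∀ x (s : ℝ), H (x + s • ν) = H x + s) ∧
      ∀ x ∈ Metric.ball x₀ r, (x ∈ Ω ↔ 0 < H x) := by
  obtain ⟨r, hr, ν, hν, γ, hγ, h⟩ := hΩ.boundary_graph x₀ hx₀
  refine ⟨r, hr, ν, hν, fun x => inner ℝ ν x -
    γ ((Submodule.span ℝ {ν})ᗮ.orthogonalProjectionOnto x), ?_, fun x s => ?_, fun x hx => ?_⟩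
  · exact (contDiff_const.inner ℝ contDiff_id).sub (hγ.comp (ContinuousLinearMap.contDiff _))
  · have h0 : (Submodule.span ℝ {ν})ᗮ.orthogonalProjectionOnto ν = 0 :=
      Submodule.orthogonalProjectionOnto_orthogonalComplement_singleton_eq_zero ν
    simp only [map_add, map_smul, h0, smul_zero, add_zero, inner_add_right, inner_smul_right,
      real_inner_self_eq_norm_sq, hν]
    ring
  · rw [sub_pos]
    exact h x hx

theorem mem_frontier_iff_defining_function_eq_zero (hΩ : IsOpen Ω) {x₀ ν : Euc n} {r : ℝ}
    {H : Euc n → ℝ} (hH : Continuous H) (hadd : ∀ x (s : ℝ), H (x + s • ν) = H x + s)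
    (h : ∀ x ∈ Metric.ball x₀ r, (x ∈ Ω ↔ 0 < H x)) {x : Euc n} (hx : x ∈ Metric.ball x₀ r) :
    x ∈ frontier Ω ↔ H x = 0 := by
  rw [hΩ.frontier_eq]
  constructor
  · rintro ⟨hc, hn⟩
    rw [h x hx, not_lt] at hn
    refine hn.eq_or_lt.resolve_right fun hlt => ?_
    obtain ⟨y, ⟨hy, hyb⟩, hyΩ⟩ := mem_closure_iff.1 hc ({y | H y < 0} ∩ Metric.ball x₀ r)
      ((isOpen_lt hH continuous_const).inter Metric.isOpen_ball) ⟨hlt, hx⟩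
    exact lt_asymm hy ((h y hyb).1 hyΩ)
  · intro h0
    refine ⟨?_, fun hxΩ => ((h x hx).1 hxΩ).ne' h0⟩
    have hcont : Continuous fun s : ℝ => x + s • ν := by fun_prop
    have hlim : Tendsto (fun s : ℝ => x + s • ν) (𝓝[>] 0) (𝓝 x) := by
      simpa using (hcont.tendsto 0).mono_left (nhdsWithin_le_nhds (s := Set.Ioi 0))
    refine mem_closure_of_tendsto hlim ?_
    filter_upwards [hlim (Metric.isOpen_ball.mem_nhds hx), self_mem_nhdsWithin] with s hs hs0
    rw [h _ hs, hadd, h0, zero_add]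
    exact hs0

/-- Derivatives within an arbitrary `s` need not be unique, so `φ'` is a chosen one, continuous at
`x₀` within `s` and therefore bounded nearby. -/
theorem ContDiffOn.exists_fderiv_bound {E : Type*} [NormedAddCommGroup E] [NormedSpace ℝ E]
    {φ : E → ℝ} {s : Set E} (hφ : ContDiffOn ℝ 1 φ s) {x₀ : E} (hx₀ : x₀ ∈ s) :
    ∃ M : ℝ, ∃ δ > 0, ∃ φ' : E → E →L[ℝ] ℝ, ∀ x ∈ Metric.ball x₀ δ ∩ s,
      ‖φ' x‖ ≤ M ∧ HasFDerivWithinAt φ (φ' x) (Metric.ball x₀ δ ∩ s) x := by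
  have h := hφ x₀ hx₀
  rw [← zero_add (1 : WithTop ℕ∞), contDiffWithinAt_succ_iff_hasFDerivWithinAt (by simp),
    Set.insert_eq_of_mem hx₀] at h
  obtain ⟨u, hu, -, φ', hφ', hcd⟩ := h
  have hc : ContinuousWithinAt φ' s x₀ := hcd.continuousWithinAt.mono_of_mem_nhdsWithin hu
  have hlt : ∀ᶠ x in 𝓝[s] x₀, ‖φ' x‖ < ‖φ' x₀‖ + 1 :=
    hc.norm.eventually_lt_const (lt_add_one _)
  obtain ⟨δ, hδ, hsub⟩ := Metric.mem_nhdsWithin_iff.1 (inter_mem hu hlt)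
  exact ⟨‖φ' x₀‖ + 1, δ, hδ, φ', fun x hx => ⟨(hsub hx).2.le,
    (hφ' x (hsub hx).1).mono fun y hy => (hsub hy).1⟩⟩

/-- Let `P y` be the boundary point vertically below `y`, and take `g = f ∘ P + M H` with `M` a
local bound for the derivative of `φ`. The segment from `P y` to `y` has length `H y` and stays in
the closure of `Ω`, so `φ y ≤ φ (P y) + M H y ≤ g y`. -/
theorem IsBoundedC1Domain.exists_local_admissible_of_mem_frontier (hΩ : IsBoundedC1Domain Ω)
    {φ f : Euc n → ℝ} (hφ : ContDiffOn ℝ 1 φ (closure Ω)) (hf : ContDiffOn ℝ 1 f (frontier Ω))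
    (hφf : ∀ x ∈ frontier Ω, φ x ≤ f x) {x₀ : Euc n} (hx₀ : x₀ ∈ frontier Ω) :
    ∃ U ∈ 𝓝 x₀, ∃ g : Euc n → ℝ, ContDiffOn ℝ 1 g U ∧
      ∀ y ∈ U, (y ∈ frontier Ω → g y = f y) ∧ (y ∈ Ω → φ y ≤ g y) := by
  obtain ⟨r, hr, ν, hν, H, hH, hadd, hHΩ⟩ := hΩ.exists_defining_function hx₀
  obtain ⟨M, δ, hδ, φ', hφ'⟩ := hφ.exists_fderiv_bound (frontier_subset_closure hx₀)
  have hfr : ∀ x ∈ Metric.ball x₀ r, (x ∈ frontier Ω ↔ H x = 0) := fun x hx =>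
    mem_frontier_iff_defining_function_eq_zero hΩ.isOpen hH.continuous hadd hHΩ hx
  set P : Euc n → Euc n := fun x => x - H x • ν with hPdef
  have hP : ContDiff ℝ 1 P := contDiff_id.sub (hH.smul contDiff_const)
  have hHP : ∀ x, H (P x) = 0 := by
    intro x
    have : P x = x + (-H x) • ν := by simp [hPdef, sub_eq_add_neg]
    rw [this, hadd, add_neg_cancel]
  have hPx : ∀ x, H x = 0 → P x = x := fun x hx => by simp [hPdef, hx]
  set B := Metric.ball x₀ r ∩ Metric.ball x₀ δ with hB
  have hBn : B ∈ 𝓝 x₀ := inter_mem (Metric.ball_mem_nhds _ hr) (Metric.ball_mem_nhds _ hδ)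
  have hBc : Convex ℝ B := (convex_ball _ _).inter (convex_ball _ _)
  have hPx₀ : P x₀ = x₀ := hPx _ ((hfr x₀ (Metric.mem_ball_self hr)).1 hx₀)
  have hPf : ∀ x, P x ∈ B → P x ∈ frontier Ω := fun x hx => (hfr _ hx.1).2 (hHP x)
  -- Requiring `P y ∈ B` as well keeps the whole segment in the convex set `B`, and puts `P y` on
  -- the frontier, where `f` is `C¹`.
  refine ⟨B ∩ P ⁻¹' B, inter_mem hBn (hP.continuous.continuousAt.preimage_mem_nhds
    (by rwa [hPx₀])), fun x => f (P x) + M * H x, ?_, fun y hy => ⟨fun hyf => ?_, fun hyΩ => ?_⟩⟩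
  · exact (hf.comp hP.contDiffOn fun x hx => hPf x hx.2).add
      (contDiff_const.mul hH).contDiffOn
  · have h0 := (hfr y hy.1.1).1 hyf
    simp only [hPx y h0, h0, mul_zero, add_zero]
  · have hHy : 0 < H y := (hHΩ y hy.1.1).1 hyΩ
    have hseg : segment ℝ (P y) y ⊆ Metric.ball x₀ δ ∩ closure Ω := by
      intro z hz
      have hzB : z ∈ B := hBc.segment_subset hy.2 hy.1 hz
      refine ⟨hzB.2, ?_⟩
      rw [segment_eq_image'] at hz
      obtain ⟨t, ht, rfl⟩ := hz
      have hHz : H (P y + t • (y - P y)) = t * H y := by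
        have : y - P y = H y • ν := by simp [hPdef]
        rw [this, smul_smul, hadd, hHP, zero_add]
      rcases ht.1.eq_or_lt with h0 | h0
      · simp only [← h0, zero_smul, add_zero]
        exact frontier_subset_closure (hPf y hy.2)
      · exact subset_closure ((hHΩ _ hzB.1).2 (by rw [hHz]; positivity))
    have hmv := (convex_segment (𝕜 := ℝ) (P y) y).norm_image_sub_le_of_norm_hasFDerivWithin_le
      (f := φ) (f' := φ') (C := M) (fun x hx => (hφ' x (hseg hx)).2.mono hseg)
      (fun x hx => (hφ' x (hseg hx)).1) (left_mem_segment ℝ _ _) (right_mem_segment ℝ _ _)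
    have hn : ‖y - P y‖ = H y := by
      simp [hPdef, norm_smul, hν, abs_of_pos hHy]
    rw [hn] at hmv
    have := (le_abs_self _).trans hmv
    linarith [hφf _ (hPf y hy.2)]

open scoped Manifold in
/-- There is a `C¹` function on `ℝⁿ` with boundary values `f` which lies above the obstacle. -/
theorem IsBoundedC1Domain.exists_contDiff_admissible (hΩ : IsBoundedC1Domain Ω)
    {φ f : Euc n → ℝ} (hφ : ContDiffOn ℝ 1 φ (closure Ω)) (hf : ContDiffOn ℝ 1 f (frontier Ω))
    (hφf : ∀ x ∈ frontier Ω, φ x ≤ f x) :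
    ∃ w : Euc n → ℝ, ContDiff ℝ 1 w ∧ (∀ x ∈ frontier Ω, w x = f x) ∧ ∀ x ∈ Ω, φ x ≤ w x := by
  -- Both requirements are pointwise convex in the value `z`, so a partition of unity preserves them
  -- and only local solutions are needed.
  set t : Euc n → Set ℝ := fun y => {z | (y ∈ frontier Ω → z = f y) ∧ (y ∈ Ω → φ y ≤ z)}
  have hconv : ∀ y, Convex ℝ (t y) := by
    rintro y z ⟨hz1, hz2⟩ z' ⟨hz1', hz2'⟩ a b ha hb hab
    refine ⟨fun hy => ?_, fun hy => ?_⟩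
    · rw [hz1 hy, hz1' hy, ← add_smul, hab, one_smul]
    · have h1 := mul_le_mul_of_nonneg_left (hz2 hy) ha
      have h2 := mul_le_mul_of_nonneg_left (hz2' hy) hb
      calc φ y = a * φ y + b * φ y := by rw [← add_mul, hab, one_mul]
        _ ≤ a • z + b • z' := add_le_add h1 h2
  have hloc : ∀ x₀, ∃ U ∈ 𝓝 x₀, ∃ g : Euc n → ℝ, ContDiffOn ℝ 1 g U ∧ ∀ y ∈ U, g y ∈ t y := by
    intro x₀
    by_cases hxf : x₀ ∈ frontier Ω
    · exact hΩ.exists_local_admissible_of_mem_frontier hφ hf hφf hxf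
    by_cases hxΩ : x₀ ∈ Ω
    · have hn : Ω ∈ 𝓝 x₀ := hΩ.isOpen.mem_nhds hxΩ
      have hc : ContinuousAt φ x₀ :=
        hφ.continuousOn.continuousAt (mem_of_superset hn subset_closure)
      have hlt : ∀ᶠ y in 𝓝 x₀, φ y < φ x₀ + 1 := hc.eventually_lt_const (lt_add_one _)
      refine ⟨_, inter_mem hn hlt, fun _ => φ x₀ + 1, contDiffOn_const,
        fun y hy => ⟨fun hyf => ?_, fun _ => (le_of_lt hy.2)⟩⟩
      rw [hΩ.isOpen.frontier_eq] at hyf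
      exact absurd hy.1 hyf.2
    · have hxc : x₀ ∉ closure Ω := fun h => hxf (by
        rw [hΩ.isOpen.frontier_eq]
        exact ⟨h, hxΩ⟩)
      exact ⟨_, isClosed_closure.isOpen_compl.mem_nhds hxc, fun _ => 0, contDiffOn_const,
        fun y hy => ⟨fun hyf => absurd (frontier_subset_closure hyf) hy,
          fun hyΩ => absurd (subset_closure hyΩ) hy⟩⟩
  obtain ⟨w, hw⟩ := exists_contMDiffMap_forall_mem_convex_of_local (n := 1) 𝓘(ℝ, Euc n) hconv
    (fun x₀ => by
      obtain ⟨U, hU, g, hg, hgt⟩ := hloc x₀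
      exact ⟨U, hU, g, hg.contMDiffOn, hgt⟩)
  exact ⟨w, w.contMDiff.contDiff, fun x hx => (hw x).1 hx, fun x hx => (hw x).2 hx⟩

end Admissible

/-! ### Convexity and completeness of the set of admissible gradients. -/

section DirectMethod

variable {n : ℕ} {Ω : Set (Euc n)}

theorem dirichletEnergy_eq (v : Lp ℝ 2 (volume.restrict Ω)) :
    dirichletEnergy Ω v = ‖weakGradient Ω v‖ ^ 2 / 2 := by
  rw [dirichletEnergy, integral_div, ← real_inner_self_eq_norm_sq, L2.inner_def]
  simp only [real_inner_self_eq_norm_sq]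

theorem obstacleClass_nonempty (hΩ : IsBoundedC1Domain Ω) {φ f : Euc n → ℝ}
    (hφ : ContDiffOn ℝ 1 φ (closure Ω)) (hf : ContDiffOn ℝ 1 f (frontier Ω))
    (hφf : ∀ x ∈ frontier Ω, φ x ≤ f x) : (obstacleClass Ω φ f).Nonempty := by
  obtain ⟨w, hw, hwf, hwφ⟩ := hΩ.exists_contDiff_admissible hφ hf hφf
  have ht := hw.hasTrace hΩ.isOpen hΩ.isBounded hwf
  refine ⟨_, ht.1, ht, ?_⟩
  filter_upwards [MemLp.coeFn_toLp (hw.continuous.memLp_restrict_of_isBounded hΩ.isBounded 2),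
    ae_restrict_mem hΩ.isOpen.measurableSet] with x hx hxΩ
  rw [hx]
  exact hwφ x hxΩ

theorem convex_obstacleClass (hΩ : IsOpen Ω) {φ f : Euc n → ℝ}
    (hf : AEStronglyMeasurable f (surfaceMeasure Ω)) : Convex ℝ (obstacleClass Ω φ f) := by
  rintro u ⟨-, hut, huφ⟩ v ⟨-, hvt, hvφ⟩ a b ha hb hab
  have ht := hut.linearCombination hΩ hf hf hvt a b
  simp only [← add_mul, hab, one_mul] at ht
  refine ⟨ht.1, ht, ?_⟩
  filter_upwards [huφ, hvφ, Lp.coeFn_add (a • u) (b • v), Lp.coeFn_smul a u, Lp.coeFn_smul b v]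
    with x h1 h2 h3 h4 h5
  rw [h3, Pi.add_apply, h4, h5, Pi.smul_apply, Pi.smul_apply, smul_eq_mul, smul_eq_mul]
  calc φ x = a * φ x + b * φ x := by rw [← add_mul, hab, one_mul]
    _ ≤ _ := add_le_add (mul_le_mul_of_nonneg_left h1 ha) (mul_le_mul_of_nonneg_left h2 hb)

theorem convex_weakGradient_image_obstacleClass (hΩ : IsOpen Ω) {φ f : Euc n → ℝ}
    (hf : AEStronglyMeasurable f (surfaceMeasure Ω)) :
    Convex ℝ (weakGradient Ω '' obstacleClass Ω φ f) := by
  rintro _ ⟨u, hu, rfl⟩ _ ⟨v, hv, rfl⟩ a b ha hb hab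
  exact ⟨_, convex_obstacleClass hΩ hf hu hv ha hb hab,
    weakGradient_linearCombination hΩ hu.1 hv.1 a b⟩

/-- The obstacle constraint survives because an `L²`-convergent sequence has a subsequence
converging a.e. -/
theorem mem_obstacleClass_of_tendsto (hΩ : IsOpen Ω) {φ f : Euc n → ℝ}
    {v : ℕ → Lp ℝ 2 (volume.restrict Ω)} {u : Lp ℝ 2 (volume.restrict Ω)}
    {g : Lp (Euc n) 2 (volume.restrict Ω)} (hv : ∀ k, v k ∈ obstacleClass Ω φ f)
    (hvu : Tendsto v atTop (𝓝 u)) (hvg : Tendsto (fun k => weakGradient Ω (v k)) atTop (𝓝 g)) :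
    u ∈ obstacleClass Ω φ f ∧ weakGradient Ω u = g := by
  obtain ⟨ht, hg⟩ := HasTrace.of_tendsto hΩ (fun k => (hv k).2.1) hvu hvg
  refine ⟨⟨ht.1, ht, ?_⟩, hg⟩
  obtain ⟨k, -, hk⟩ := (tendstoInMeasure_of_tendsto_Lp hvu).exists_seq_tendsto_ae
  filter_upwards [hk, ae_all_iff.2 fun j => (hv j).2.2] with x hx hφ
  exact ge_of_tendsto' hx fun i => hφ (k i)

/-- In the obstacle class, the `L²` distance is controlled by that of the gradients. -/
theorem exists_norm_sub_le_of_mem_obstacleClass {m : ℕ} {Ω : Set (Euc (m + 1))} (hΩ : IsOpen Ω)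
    (hb : Bornology.IsBounded Ω) {φ f : Euc (m + 1) → ℝ}
    (hf : AEStronglyMeasurable f (surfaceMeasure Ω)) :
    ∃ C : NNReal, ∀ u ∈ obstacleClass Ω φ f, ∀ v ∈ obstacleClass Ω φ f,
      ‖u - v‖ ≤ C * ‖weakGradient Ω u - weakGradient Ω v‖ := by
  obtain ⟨C, hC⟩ := HasTrace.friedrichs hΩ hb
  refine ⟨C, fun u hu v hv => ?_⟩
  -- The common boundary values cancel, so `u - v` has zero trace.
  have ht := hu.2.1.linearCombination hΩ hf hf hv.2.1 1 (-1)
  simp only [one_mul, neg_mul, add_neg_cancel] at ht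
  have h := hC _ ht
  rw [weakGradient_linearCombination hΩ hu.1 hv.1] at h
  simpa only [one_smul, neg_smul, ← sub_eq_add_neg] using h

/-- If admissible gradients converge, Friedrichs makes the functions themselves Cauchy; their limit
is admissible and has the limiting gradient. -/
theorem isComplete_weakGradient_image_obstacleClass {m : ℕ} {Ω : Set (Euc (m + 1))}
    (hΩ : IsOpen Ω) (hb : Bornology.IsBounded Ω) {φ f : Euc (m + 1) → ℝ}
    (hf : AEStronglyMeasurable f (surfaceMeasure Ω)) :
    IsComplete (weakGradient Ω '' obstacleClass Ω φ f) := by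
  obtain ⟨C, hC⟩ := exists_norm_sub_le_of_mem_obstacleClass hΩ hb (φ := φ) hf
  refine IsClosed.isComplete (isClosed_of_closure_subset fun g hg => ?_)
  obtain ⟨q, hq, hqg⟩ := mem_closure_iff_seq_limit.1 hg
  choose v hv hvq using hq
  have hcauchy : CauchySeq v := by
    rw [Metric.cauchySeq_iff]
    intro ε hε
    -- `C + 1` rather than `C`, which may be zero.
    obtain ⟨N, hN⟩ := Metric.cauchySeq_iff.1 hqg.cauchySeq (ε / (C + 1)) (by positivity)
    refine ⟨N, fun i hi j hj => ?_⟩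
    have h := hN i hi j hj
    rw [dist_eq_norm, lt_div_iff₀ (by positivity)] at h
    have h' := hC _ (hv i) _ (hv j)
    rw [hvq, hvq] at h'
    rw [dist_eq_norm]
    nlinarith [norm_nonneg (q i - q j)]
  obtain ⟨u, hu⟩ := cauchySeq_tendsto_of_complete hcauchy
  obtain ⟨hmem, hgrad⟩ := mem_obstacleClass_of_tendsto hΩ hv hu
    (hqg.congr fun k => (hvq k).symm)
  exact ⟨u, hmem, hgrad⟩

end DirectMethod

/-! ### Existence and uniqueness of the minimizer. -/

theorem mainTheorem5 (n : ℕ) (hn : 1 ≤ n) (Ω : Set (Euc n)) (hΩ : IsBoundedC1Domain Ω)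
    (φ f : Euc n → ℝ) (hφ : ContDiffOn ℝ 1 φ (closure Ω)) (hf : ContDiffOn ℝ 1 f (frontier Ω))
    (hφf : ∀ x ∈ frontier Ω, φ x ≤ f x) :
    ∃! u : Lp ℝ 2 (volume.restrict Ω), u ∈ obstacleClass Ω φ f ∧
      ∀ v ∈ obstacleClass Ω φ f, dirichletEnergy Ω u ≤ dirichletEnergy Ω v := by
  -- Friedrichs' inequality integrates along coordinate `0`, so the dimension must be positive.
  obtain ⟨m, rfl⟩ : ∃ m, n = m + 1 := ⟨n - 1, by omega⟩
  have hfm : AEStronglyMeasurable f (surfaceMeasure Ω) :=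
    hf.continuousOn.aestronglyMeasurable isClosed_frontier.measurableSet
  have hconv := convex_weakGradient_image_obstacleClass hΩ.isOpen (φ := φ) hfm
  obtain ⟨_, ⟨u, hu, rfl⟩, hmin⟩ := exists_norm_eq_iInf_of_complete_convex
    ((obstacleClass_nonempty hΩ hφ hf hφf).image _)
    (isComplete_weakGradient_image_obstacleClass hΩ.isOpen hΩ.isBounded hfm) hconv 0
  have hvar := (norm_eq_iInf_iff_real_inner_le_zero hconv (Set.mem_image_of_mem _ hu)).1 hmin
  -- The variational inequality says `⟨∇u, ∇v - ∇u⟩ ≥ 0`. The resulting gap estimate yields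
  -- minimality, and forces any other minimizer to have the same gradient.
  have hgap : ∀ v ∈ obstacleClass Ω φ f, ‖weakGradient Ω u - weakGradient Ω v‖ ^ 2 ≤
      ‖weakGradient Ω v‖ ^ 2 - ‖weakGradient Ω u‖ ^ 2 := by
    intro v hv
    have h := hvar _ (Set.mem_image_of_mem _ hv)
    rw [zero_sub, inner_neg_left, inner_sub_right, real_inner_self_eq_norm_sq] at h
    rw [norm_sub_sq_real]
    linarith
  refine ⟨u, ⟨hu, fun v hv => ?_⟩, fun v ⟨hv, hvmin⟩ => ?_⟩
  · rw [dirichletEnergy_eq, dirichletEnergy_eq]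
    linarith [hgap v hv, sq_nonneg ‖weakGradient Ω u - weakGradient Ω v‖]
  · have hle := hvmin u hu
    rw [dirichletEnergy_eq, dirichletEnergy_eq] at hle
    have hzero : ‖weakGradient Ω u - weakGradient Ω v‖ = 0 :=
      pow_eq_zero_iff two_ne_zero |>.1 (le_antisymm (by linarith [hgap v hv]) (sq_nonneg _))
    -- Equal gradients and equal traces give equal functions.
    obtain ⟨C, hC⟩ := exists_norm_sub_le_of_mem_obstacleClass hΩ.isOpen hΩ.isBounded (φ := φ) hfm
    have h := hC u hu v hv
    rw [hzero, mul_zero] at h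
    exact (sub_eq_zero.1 (norm_le_zero_iff.1 h)).symm
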